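/- Let $S\ge 1$ be an integer and let $a,b:[0,\infty)\to[0,\infty)$ be locally integrable and asymptotically periodic: $a=a_1+a_2$, $b=b_1+b_2$, where $a_1(t+T_1)=a_1(t)$, $b_1(t+T_2)=b_1(t)$ for $t\ge 0$ ($T_1,T_2>0$) and $a_2(t),b_2(t)\to 0$ as $t\to\infty$. Put $a_m=\frac1{T_1}\int_0^{T_1}a_1(u)\,du$ and $b_m=\frac1{T_2}\int_0^{T_2}b_1(u)\,du$. The $M_t/M_t/S$ queue is the birth-death process on $\{0,1,2,\dots\}$ with birth rates $\lambda_n(t)=a(t)$ and death rates $\mu_n(t)=b(t)\min(n,S)$. Assume that it is underloaded, $a_m<S\,b_m$. (1) For every $\Delta>1$ put $c=\min\left(\frac1S,\frac{\Delta-1}{\Delta}\right)$. There is a sequence of positive numbers $(\delta_k)_{k\ge 0}$ with $\liminf_{k\to\infty}\delta_k>1$ such that the functions $\alpha_k(t)=\lambda_k(t)+\mu_{k+1}(t)-\delta_{k+1}\lambda_{k+1}(t)-\delta_k^{-1}\mu_k(t)$ satisfy $$\inf_{k\ge 0}\alpha_k(t)\ \ge\ c\,\bigl(S\,b(t)-\Delta\,a(t)\bigr)\qquad\text{for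 all } t\ge 0 .$$ (2) Assume moreover $a_m>0$, put $\rho=\frac{a_m}{S\,b_m}\in(0,1)$, take $\Delta=\rho^{-1/2}$, so that $c=\min\left(\frac1S,1-\rho^{1/2}\right)$, and let $\dot\alpha(t)=c\,\bigl(S\,b(t)-\rho^{-1/2}a(t)\bigr)$. Let $\mathbf p^1(t),\mathbf p^2(t)$, $t\ge 0$, be any two solutions of the forward Kolmogorov system of the queue (in the integrated, Carathéodory sense) whose values are probability vectors. Then for all $0\le s\le t$ $$\sum_{i\ge 0}\left|p^1_i(t)-p^2_i(t)\right|\ \le\ 4\,e^{-\int_s^t\dot\alpha(u)\,du}\ \sum_{i\ge 1}\Bigl(\sum_{m=0}^{i-1}\rho^{-m/2}\Bigr)\left|p^1_i(s)-p^2_i(s)\right| ,$$ where the right-hand side may be $+\infty$. -/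

import Mathlib

open Filter Topology MeasureTheory
open scoped ENNReal

noncomputable section

namespace BDQueue

/-- `f = f₁ + f₂` on `[0, ∞)`, where `f₁` has period `T > 0` and `f₂` vanishes at infinity. -/
structure IsAsympPeriodic (f f₁ f₂ : ℝ → ℝ) (T : ℝ) : Prop where
  period_pos : 0 < T
  decomp : ∀ t, 0 ≤ t → f t = f₁ t + f₂ t
  periodic : ∀ t, 0 ≤ t → f₁ (t + T) = f₁ t
  vanishing : Tendsto f₂ atTop (𝓝 0)

/-- The basic functions of the intensities: nonnegative and locally integrable on `[0, ∞)`. -/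
structure IsIntensity (f : ℝ → ℝ) : Prop where
  nonneg : ∀ t, 0 ≤ t → 0 ≤ f t
  locallyIntegrable : LocallyIntegrableOn f (Set.Ici 0) volume

/-- The mean value over one period. -/
def periodMean (f₁ : ℝ → ℝ) (T : ℝ) : ℝ := (1 / T) * ∫ u in (0 : ℝ)..T, f₁ u

/-- The right-hand side `(A(t) x)_n` of the forward Kolmogorov system of the birth-death process
on `ℕ` with birth rates `lam n t` and death rates `mu n t` (where `mu 0 t = 0`). -/
def forwardRHS (lam mu : ℕ → ℝ → ℝ) (t : ℝ) (x : ℕ → ℝ) : ℕ → ℝ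
  | 0 => mu 1 t * x 1 - lam 0 t * x 0
  | n + 1 => lam n t * x n - (lam (n + 1) t + mu (n + 1) t) * x (n + 1) + mu (n + 2) t * x (n + 2)

/-- `p` is a probability-vector valued solution on `[0, ∞)` of the forward Kolmogorov system.
The rates are only locally integrable, so the system is understood in the Caratheodory
(integrated) sense. -/
structure IsStateProbability (lam mu : ℕ → ℝ → ℝ) (p : ℝ → ℕ → ℝ) : Prop where
  nonneg : ∀ t, 0 ≤ t → ∀ n, 0 ≤ p t n
  hasSum_one : ∀ t, 0 ≤ t → HasSum (p t) 1
  intervalIntegrable : ∀ n t, 0 ≤ t →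
    IntervalIntegrable (fun u => forwardRHS lam mu u (p u) n) volume 0 t
  eq_integral : ∀ n t, 0 ≤ t →
    p t n = p 0 n + ∫ u in (0 : ℝ)..t, forwardRHS lam mu u (p u) n

/-- `α_k(t) = λ_k(t) + μ_{k+1}(t) - δ_{k+1} λ_{k+1}(t) - δ_k⁻¹ μ_k(t)`.
For `k = 0` the last term is zero, because `μ_0 = 0`. -/
def alpha (lam mu : ℕ → ℝ → ℝ) (δ : ℕ → ℝ) (k : ℕ) (t : ℝ) : ℝ :=
  lam k t + mu (k + 1) t - δ (k + 1) * lam (k + 1) t - (δ k)⁻¹ * mu k t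

/-- `inf_k α_k(t)`. -/
def alphaInf (lam mu : ℕ → ℝ → ℝ) (δ : ℕ → ℝ) (t : ℝ) : ℝ := ⨅ k, alpha lam mu δ k t

/-- Birth rates `λ_n(t) = a(t)` of the queue. -/
def queueBirth (a : ℝ → ℝ) : ℕ → ℝ → ℝ := fun _ t => a t

/-- Death rates `μ_n(t) = b(t) min(n, S)` of the queue. -/
def queueDeath (S : ℕ) (b : ℝ → ℝ) : ℕ → ℝ → ℝ := fun n t => b t * (min n S : ℕ)

/-- `c = min (1/S, (Δ - 1)/Δ)`. -/
def rateConst (S : ℕ) (Δ : ℝ) : ℝ := min (1 / (S : ℝ)) ((Δ - 1) / Δ)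

/-- `c (S b(t) - Δ a(t))` with `c = min (1/S, (Δ - 1)/Δ)`. -/
def rate (S : ℕ) (a b : ℝ → ℝ) (Δ : ℝ) (t : ℝ) : ℝ :=
  rateConst S Δ * ((S : ℝ) * b t - Δ * a t)

/-- The `ℓ₁` distance, with values in `[0, ∞]`. -/
def l1Dist (x y : ℕ → ℝ) : ℝ≥0∞ := ∑' i, ENNReal.ofReal |x i - y i|

/-- `∑_{i ≥ 1} (∑_{m=0}^{i-1} ρ^{-m/2}) |x_i - y_i|`, with values in `[0, ∞]`
(the term `i = 0` below is zero). -/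
def weightedDist (ρ : ℝ) (x y : ℕ → ℝ) : ℝ≥0∞ :=
  ∑' i : ℕ, ENNReal.ofReal ((∑ m ∈ Finset.range i, ρ ^ (-(m : ℝ) / 2)) * |x i - y i|)

end BDQueue

end

noncomputable section

namespace BDQueue

/-! Let Z_k be the sum of the first k coordinates of p¹ - p². Summing the Kolmogorov equations
leaves only the flux across one edge (`sum_forwardRHS`), so the Z_k solve a tridiagonal linear
system with nonnegative off-diagonal coefficients. Hence |Z_k| satisfies the corresponding
differential inequality almost everywhere. Give Z_{k+1} the weight v_{k+1} = δ_1⋯δ_k; the column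
sums of the weighted system are then -α_k, so a lower bound for all α_k is a decay rate for Σ
v_{k+1}|Z_{k+1}|.

Take δ_k = 1 for k < S and δ_k = 1 + cΔ afterwards. The births then cost at most cΔa, and the deaths
gain at least cSb: below S because cS ≤ 1, from S on because cΔ ≤ Δ - 1. The latter inequality also
gives δ_k ≤ Δ, so v_{k+1} ≤ Δ^k = ρ^{-k/2}.

The sum is infinite, so it is cut at N, which leaves a boundary term μ_N v_N |Z_{N+1}|
(`exp_mul_weightedSum_le`). Removing it requires the weighted sum to stay finite. This is proved
first with bounded weights and a crude growth rate (`weightedSum_le_exp_mul`), and the sharp rate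
follows in `exp_rate_mul_weightedSum_le`. The weighted sum is finally compared with the two
distances. -/

/-! ### Absolutely continuous functions and Grönwall's inequality. -/

lemma absolutelyContinuousOnInterval_congr {f g : ℝ → ℝ} {s t : ℝ}
    (hf : AbsolutelyContinuousOnInterval f s t) (hfg : Set.EqOn f g (Set.uIcc s t)) :
    AbsolutelyContinuousOnInterval g s t := by
  rw [absolutelyContinuousOnInterval_iff] at hf ⊢
  intro ε hε
  obtain ⟨η, hη, h⟩ := hf ε hε
  refine ⟨η, hη, fun E hE hlt => ?_⟩
  rw [Finset.sum_congr rfl (fun i hi => ?_)]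
  · exact h E hE hlt
  · rw [hfg (hE.1 i hi).1, hfg (hE.1 i hi).2]

lemma absolutelyContinuousOnInterval_lipschitz_comp {f φ : ℝ → ℝ} {s t : ℝ} {K : NNReal}
    (hf : AbsolutelyContinuousOnInterval f s t)
    (hφ : LipschitzOnWith K φ (f '' Set.uIcc s t)) :
    AbsolutelyContinuousOnInterval (fun u => φ (f u)) s t := by
  rw [absolutelyContinuousOnInterval_iff] at hf ⊢
  intro ε hε
  have hK : (0 : ℝ) < K + 1 := by positivity
  obtain ⟨η, hη, h⟩ := hf (ε / (K + 1)) (by positivity)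
  refine ⟨η, hη, fun E hE hlt => ?_⟩
  have h1 := h E hE hlt
  rw [lt_div_iff₀ hK] at h1
  refine lt_of_le_of_lt ?_ h1
  rw [Finset.sum_mul]
  refine Finset.sum_le_sum fun i hi => ?_
  have := hφ.dist_le_mul _ ⟨_, (hE.1 i hi).1, rfl⟩ _ ⟨_, (hE.1 i hi).2, rfl⟩
  have h0 : 0 ≤ dist (f (E.2 i).1) (f (E.2 i).2) := dist_nonneg
  nlinarith

lemma absolutelyContinuousOnInterval_abs {f : ℝ → ℝ} {s t : ℝ}
    (hf : AbsolutelyContinuousOnInterval f s t) :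
    AbsolutelyContinuousOnInterval (fun u => |f u|) s t :=
  absolutelyContinuousOnInterval_lipschitz_comp (φ := fun x => |x|) (K := 1) hf
    (LipschitzWith.of_dist_le_mul fun x y => by
      simpa [Real.dist_eq] using abs_abs_sub_abs_le x y).lipschitzOnWith

lemma absolutelyContinuousOnInterval_exp {f : ℝ → ℝ} {s t : ℝ}
    (hf : AbsolutelyContinuousOnInterval f s t) :
    AbsolutelyContinuousOnInterval (fun u => Real.exp (f u)) s t := by
  obtain ⟨C, hC⟩ := hf.exists_bound
  obtain ⟨K, hK⟩ := (Real.contDiff_exp (n := 1)).contDiffOn.exists_lipschitzOnWith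
    (s := Set.Icc (-C) C) (by decide) (convex_Icc _ _) isCompact_Icc
  refine absolutelyContinuousOnInterval_lipschitz_comp hf (hK.mono ?_)
  rintro _ ⟨u, hu, rfl⟩
  exact abs_le.1 (hC u hu)

lemma absolutelyContinuousOnInterval_sum {ι : Type*} {f : ι → ℝ → ℝ} {s t : ℝ} (I : Finset ι)
    (hf : ∀ i ∈ I, AbsolutelyContinuousOnInterval (f i) s t) :
    AbsolutelyContinuousOnInterval (fun u => ∑ i ∈ I, f i u) s t := by
  classical
  induction I using Finset.induction_on with
  | empty =>
    simpa using (LipschitzWith.const (0 : ℝ)).lipschitzOnWith.absolutelyContinuousOnInterval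
  | insert i I hi ih =>
    simp only [Finset.sum_insert hi]
    exact (hf i (by simp)).fun_add (ih fun j hj => hf j (by simp [hj]))

/-- A differential form of Grönwall's inequality for absolutely continuous functions. -/
lemma exp_mul_le_of_deriv_le {W r B : ℝ → ℝ} {s t : ℝ} (hst : s ≤ t)
    (hW : AbsolutelyContinuousOnInterval W s t)
    (hr : IntervalIntegrable r volume s t) (hB : IntervalIntegrable B volume s t)
    (hB0 : ∀ u ∈ Set.Icc s t, 0 ≤ B u)
    (hd : ∀ᵐ u, u ∈ Set.Ioo s t → deriv W u ≤ -r u * W u + B u) :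
    Real.exp (∫ u in s..t, r u) * W t ≤
      W s + Real.exp (∫ u in s..t, |r u|) * ∫ u in s..t, B u := by
  set E : ℝ → ℝ := fun v => Real.exp (∫ u in s..v, r u) with hE
  have hEac : AbsolutelyContinuousOnInterval E s t :=
    absolutelyContinuousOnInterval_exp
      (hr.absolutelyContinuousOnInterval_intervalIntegral (by simp))
  have key := (hEac.fun_mul hW).integral_deriv_eq_sub
  have hle : ∫ u in s..t, deriv (fun x => E x * W x) u ≤
      ∫ u in s..t, Real.exp (∫ u in s..t, |r u|) * B u := by
    refine intervalIntegral.integral_mono_ae_restrict hst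
      (hEac.fun_mul hW).intervalIntegrable_deriv (hB.const_mul _) ?_
    rw [← Measure.restrict_congr_set Ioo_ae_eq_Icc]
    refine (ae_restrict_iff' measurableSet_Ioo).2 ?_
    filter_upwards [hd, hW.ae_differentiableAt, hr.ae_hasDerivAt_integral] with u h1 h2 h3 hu
    have huI : u ∈ Set.uIcc s t := by
      rw [Set.uIcc_of_le hst]; exact Set.Ioo_subset_Icc_self hu
    have hE' : HasDerivAt E (E u * r u) u := (h3 huI s (by simp)).exp
    have := (hE'.mul (h2 huI).hasDerivAt).deriv
    change deriv (E * W) u ≤ _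
    rw [this]
    -- `r` may change sign, so the integrating factor is bounded through |r|.
    have hEle : E u ≤ Real.exp (∫ u in s..t, |r u|) := by
      refine Real.exp_le_exp.2 ((le_abs_self _).trans ?_)
      refine (intervalIntegral.abs_integral_le_integral_abs hu.1.le).trans ?_
      refine intervalIntegral.integral_mono_interval le_rfl hu.1.le hu.2.le
        (Eventually.of_forall fun _ => abs_nonneg _) hr.abs
    have hE0 : 0 < E u := Real.exp_pos _
    have h4 := mul_le_mul_of_nonneg_left (h1 hu) hE0.le
    have h5 := mul_le_mul_of_nonneg_right hEle (hB0 u (Set.Ioo_subset_Icc_self hu))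
    linarith
  rw [key, intervalIntegral.integral_const_mul] at hle
  have hEs : E s = 1 := by simp [hE]
  rw [hEs] at hle
  change E t * W t ≤ _
  linarith

lemma deriv_abs_le_of_hasDerivAt {f : ℝ → ℝ} {u q h : ℝ} (hf : HasDerivAt f (-q * f u + h) u) :
    deriv (fun x => |f x|) u ≤ -q * |f u| + |h| := by
  rcases lt_trichotomy (f u) 0 with h0 | h0 | h0
  · have := ((hasDerivAt_abs_neg h0).comp u hf).deriv
    change deriv (fun x => |f x|) u = _ at this
    rw [this, abs_of_neg h0]
    linarith [neg_abs_le h]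
  -- At a zero of `f`, |f| has a minimum, so `deriv` is 0 there, by default if |f| is not
  -- differentiable.
  · rw [IsLocalMin.deriv_eq_zero]
    · simp [h0]
    · exact Eventually.of_forall fun x => by simp [h0]
  · have := ((hasDerivAt_abs_pos h0).comp u hf).deriv
    change deriv (fun x => |f x|) u = _ at this
    rw [this, abs_of_pos h0]
    linarith [le_abs_self h]

/-! ### Decay of weighted sums for a general birth-death system. -/

/-- Summation by parts for the weighted right-hand side of the system of partial sums. -/
lemma sum_weighted_generator (lam mu v A : ℕ → ℝ) (hv : v 0 = 0) (hA : A 0 = 0) (N : ℕ) :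
    ∑ k ∈ Finset.range N,
        v (k + 1) * (-(lam k + mu (k + 1)) * A (k + 1) + (lam k * A k + mu (k + 1) * A (k + 2))) =
      -(∑ k ∈ Finset.range N,
        ((lam k + mu (k + 1)) * v (k + 1) - lam (k + 1) * v (k + 2) - mu k * v k) * A (k + 1)) -
      lam N * v (N + 1) * A N + v N * mu N * A (N + 1) := by
  induction N with
  | zero => simp [hv, hA]
  | succ N ih =>
    rw [Finset.sum_range_succ, Finset.sum_range_succ, ih]
    ring

/-- Weighted sums of the solutions of the system of partial sums decay at the rate `r`, provided
that the boundary terms of the truncated sums vanish in the limit. -/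
lemma exp_mul_weightedSum_le {lam mu : ℕ → ℝ → ℝ} {Z : ℕ → ℝ → ℝ} {v : ℕ → ℝ} {r g : ℝ → ℝ}
    {s t K V : ℝ} (hst : s ≤ t)
    (hlam : ∀ k, ∀ u ∈ Set.Icc s t, 0 ≤ lam k u) (hmu : ∀ k, ∀ u ∈ Set.Icc s t, 0 ≤ mu k u)
    (hmuint : ∀ k, IntervalIntegrable (mu k) volume s t)
    (hg : IntervalIntegrable g volume s t) (hmug : ∀ k, ∀ u ∈ Set.Icc s t, mu k u ≤ g u)
    (hr : IntervalIntegrable r volume s t)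
    (hZ0 : ∀ u, Z 0 u = 0)
    (hZac : ∀ k, AbsolutelyContinuousOnInterval (Z k) s t)
    (hZ : ∀ k, ∀ᵐ u, u ∈ Set.Ioo s t → HasDerivAt (Z (k + 1))
      (-(lam k u + mu (k + 1) u) * Z (k + 1) u +
        (lam k u * Z k u + mu (k + 1) u * Z (k + 2) u)) u)
    (hv0 : v 0 = 0) (hv : ∀ k, 0 ≤ v k)
    (hrv : ∀ k, ∀ u ∈ Set.Icc s t, r u * v (k + 1) ≤
      (lam k u + mu (k + 1) u) * v (k + 1) - lam (k + 1) u * v (k + 2) - mu k u * v k)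
    (hbdd : ∀ k, ∀ u ∈ Set.Icc s t, v k * |Z (k + 1) u| ≤ K)
    (hlim : ∀ u ∈ Set.Icc s t, Tendsto (fun k => v k * |Z (k + 1) u|) atTop (𝓝 0))
    (hV : ∀ N, ∑ k ∈ Finset.range N, v (k + 1) * |Z (k + 1) s| ≤ V) (N : ℕ) :
    Real.exp (∫ u in s..t, r u) * ∑ k ∈ Finset.range N, v (k + 1) * |Z (k + 1) t| ≤ V := by
  set W : ℕ → ℝ → ℝ := fun N u => ∑ k ∈ Finset.range N, v (k + 1) * |Z (k + 1) u| with hW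
  set B : ℕ → ℝ → ℝ := fun N u => mu N u * (v N * |Z (N + 1) u|) with hB
  have hvZ : ∀ k u, 0 ≤ v k * |Z (k + 1) u| := fun k u => mul_nonneg (hv k) (abs_nonneg _)
  have habs : ∀ k, AbsolutelyContinuousOnInterval (fun u => |Z k u|) s t := fun k =>
    absolutelyContinuousOnInterval_abs (hZac k)
  have hBint : ∀ N, IntervalIntegrable (B N) volume s t := fun N =>
    (hmuint N).mul_continuousOn (continuousOn_const.mul (habs (N + 1)).continuousOn)
  have hderiv : ∀ N, ∀ᵐ u, u ∈ Set.Ioo s t → deriv (W N) u ≤ -r u * W N u + B N u := by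
    intro N
    have h1 := ae_all_iff.2 hZ
    have h2 := ae_all_iff.2 fun k => (habs k).ae_differentiableAt
    filter_upwards [h1, h2] with u h1 h2 hu
    have huI := Set.Ioo_subset_Icc_self hu
    have hd : ∀ k, DifferentiableAt ℝ (fun u => |Z k u|) u := fun k =>
      h2 k (by rwa [Set.uIcc_of_le hst])
    rw [hW]
    simp only
    rw [deriv_fun_sum fun k _ => (hd (k + 1)).const_mul _]
    calc ∑ k ∈ Finset.range N, deriv (fun u => v (k + 1) * |Z (k + 1) u|) u
        ≤ ∑ k ∈ Finset.range N, v (k + 1) * (-(lam k u + mu (k + 1) u) * |Z (k + 1) u| +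
            (lam k u * |Z k u| + mu (k + 1) u * |Z (k + 2) u|)) := by
          refine Finset.sum_le_sum fun k _ => ?_
          rw [deriv_const_mul _ (hd (k + 1))]
          refine mul_le_mul_of_nonneg_left ?_ (hv _)
          refine (deriv_abs_le_of_hasDerivAt (h1 k hu)).trans ?_
          have := abs_add_le (lam k u * Z k u) (mu (k + 1) u * Z (k + 2) u)
          rw [abs_mul, abs_mul, abs_of_nonneg (hlam k u huI), abs_of_nonneg (hmu _ u huI)] at this
          linarith
      _ = _ := sum_weighted_generator (fun k => lam k u) (fun k => mu k u) v
          (fun k => |Z k u|) hv0 (by simp [hZ0]) N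
      _ ≤ -r u * (∑ k ∈ Finset.range N, v (k + 1) * |Z (k + 1) u|) + B N u := by
          -- Of the two boundary terms, the birth term has the favourable sign and is dropped; the
          -- death term is `B N u`.
          have h3 : 0 ≤ lam N u * v (N + 1) * |Z N u| :=
            mul_nonneg (mul_nonneg (hlam _ _ huI) (hv _)) (abs_nonneg _)
          have h4 : r u * (∑ k ∈ Finset.range N, v (k + 1) * |Z (k + 1) u|) ≤
              ∑ k ∈ Finset.range N, ((lam k u + mu (k + 1) u) * v (k + 1) -
                lam (k + 1) u * v (k + 2) - mu k u * v k) * |Z (k + 1) u| := by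
            rw [Finset.mul_sum]
            refine Finset.sum_le_sum fun k _ => ?_
            rw [← mul_assoc]
            exact mul_le_mul_of_nonneg_right (hrv k u huI) (abs_nonneg _)
          simp only [hB]
          linarith
  have hstep : ∀ M, Real.exp (∫ u in s..t, r u) * W M t ≤
      V + Real.exp (∫ u in s..t, |r u|) * ∫ u in s..t, B M u := by
    intro M
    refine (exp_mul_le_of_deriv_le hst ?_ hr (hBint M) ?_ (hderiv M)).trans ?_
    · exact absolutelyContinuousOnInterval_sum _ fun k _ => (habs (k + 1)).const_mul _
    · exact fun u hu => mul_nonneg (hmu _ u hu) (hvZ _ _)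
    · linarith [hV M]
  have hBlim : Tendsto (fun M => ∫ u in s..t, B M u) atTop (𝓝 0) := by
    have : Tendsto (fun M => ∫ u in s..t, B M u) atTop (𝓝 (∫ _ in s..t, (0 : ℝ))) := by
      refine intervalIntegral.tendsto_integral_filter_of_dominated_convergence
        (fun u => g u * K) (Eventually.of_forall fun M => (hBint M).aestronglyMeasurable_restrict_uIoc) ?_
        (hg.mul_const K) ?_
      · refine Eventually.of_forall fun M => Eventually.of_forall fun u hu => ?_
        rw [Set.uIoc_of_le hst] at hu
        have hu' := Set.Ioc_subset_Icc_self hu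
        rw [Real.norm_of_nonneg (mul_nonneg (hmu _ _ hu') (hvZ _ _))]
        exact mul_le_mul (hmug _ _ hu') (hbdd _ _ hu') (hvZ _ _)
          ((hmu M u hu').trans (hmug M u hu'))
      · refine Eventually.of_forall fun u hu => ?_
        rw [Set.uIoc_of_le hst] at hu
        have hu' := Set.Ioc_subset_Icc_self hu
        have h0 := (hlim u hu').const_mul (g u)
        rw [mul_zero] at h0
        exact squeeze_zero (fun M => mul_nonneg (hmu _ _ hu') (hvZ _ _))
          (fun M => mul_le_mul_of_nonneg_right (hmug _ _ hu') (hvZ _ _)) h0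
    simpa using this
  have hlim' : Tendsto (fun M => V + Real.exp (∫ u in s..t, |r u|) * ∫ u in s..t, B M u)
      atTop (𝓝 V) := by
    simpa using tendsto_const_nhds.add (hBlim.const_mul (Real.exp (∫ u in s..t, |r u|)))
  -- The sum up to `N` is enlarged to a sum up to `M`, and the boundary contribution disappears as
  -- `M` grows.
  refine ge_of_tendsto hlim' ((eventually_ge_atTop N).mono fun M hM => le_trans ?_ (hstep M))
  refine mul_le_mul_of_nonneg_left ?_ (Real.exp_pos _).le
  exact Finset.sum_le_sum_of_subset_of_nonneg (Finset.range_mono hM) fun k _ _ =>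
    mul_nonneg (hv _) (abs_nonneg _)

/-! ### Ratios and weights for the queue. -/

lemma IsIntensity.intervalIntegrable {f : ℝ → ℝ} (hf : IsIntensity f) {s t : ℝ} (hs : 0 ≤ s)
    (hst : s ≤ t) : IntervalIntegrable f volume s t := by
  rw [intervalIntegrable_iff_integrableOn_Icc_of_le hst]
  exact hf.locallyIntegrable.integrableOn_compact_subset
    (fun u hu => hs.trans hu.1) isCompact_Icc

/-- The ratios `δ_k` of consecutive weights. -/
def queueDelta (S : ℕ) (Δ : ℝ) (k : ℕ) : ℝ := if k < S then 1 else 1 + rateConst S Δ * Δ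

lemma rateConst_pos {S : ℕ} (hS : 1 ≤ S) {Δ : ℝ} (hΔ : 1 < Δ) : 0 < rateConst S Δ := by
  have : (0 : ℝ) < S := by exact_mod_cast hS
  exact lt_min (by positivity) (div_pos (by linarith) (by linarith))

lemma rateConst_mul_card_le {S : ℕ} (hS : 1 ≤ S) (Δ : ℝ) : rateConst S Δ * S ≤ 1 := by
  have : (0 : ℝ) < S := by exact_mod_cast hS
  exact (le_div_iff₀ this).1 (min_le_left _ _)

lemma rateConst_mul_le (S : ℕ) {Δ : ℝ} (hΔ : 1 < Δ) : rateConst S Δ * Δ ≤ Δ - 1 :=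
  (le_div_iff₀ (by linarith)).1 (min_le_right _ _)

lemma one_le_queueDelta {S : ℕ} (hS : 1 ≤ S) {Δ : ℝ} (hΔ : 1 < Δ) (k : ℕ) :
    1 ≤ queueDelta S Δ k := by
  have := mul_pos (rateConst_pos hS hΔ) (by linarith : 0 < Δ)
  unfold queueDelta
  split_ifs <;> linarith

lemma queueDelta_le_one_add {S : ℕ} (hS : 1 ≤ S) {Δ : ℝ} (hΔ : 1 < Δ) (k : ℕ) :
    queueDelta S Δ k ≤ 1 + rateConst S Δ * Δ := by
  have := mul_pos (rateConst_pos hS hΔ) (by linarith : 0 < Δ)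
  unfold queueDelta
  split_ifs <;> linarith

lemma queueDelta_le {S : ℕ} (hS : 1 ≤ S) {Δ : ℝ} (hΔ : 1 < Δ) (k : ℕ) :
    queueDelta S Δ k ≤ Δ := by
  linarith [queueDelta_le_one_add hS hΔ k, rateConst_mul_le S hΔ]

/-- This is the coefficient of b in α_k. For k < S the right side is 1; for k ≥ S it is S(1 - 1/(1 +
cΔ)). Each entry of the minimum defining c serves one case. -/
lemma rateConst_mul_le_min_sub {S : ℕ} (hS : 1 ≤ S) {Δ : ℝ} (hΔ : 1 < Δ) (k : ℕ) :
    rateConst S Δ * S ≤ (min (k + 1) S : ℕ) - (queueDelta S Δ k)⁻¹ * (min k S : ℕ) := by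
  by_cases hk : k < S
  · rw [min_eq_left (by omega), min_eq_left (by omega), queueDelta, if_pos hk]
    push_cast
    linarith [rateConst_mul_card_le hS Δ]
  · rw [min_eq_right (by omega), min_eq_right (by omega)]
    have hc := rateConst_pos hS hΔ
    have h1 := rateConst_mul_le S hΔ
    have hδ : queueDelta S Δ k = 1 + rateConst S Δ * Δ := if_neg hk
    have hpos : 0 < 1 + rateConst S Δ * Δ := by
      rw [← hδ]; linarith [one_le_queueDelta hS hΔ k]
    have h2 : (queueDelta S Δ k)⁻¹ ≤ 1 - rateConst S Δ := by
      rw [hδ, inv_le_iff_one_le_mul₀ hpos]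
      -- (1 - c)(1 + cΔ) - 1 = c(Δ - 1 - cΔ) ≥ 0.
      nlinarith
    have h3 := mul_le_mul_of_nonneg_right h2 (Nat.cast_nonneg (α := ℝ) S)
    linarith

lemma rate_le_alpha {S : ℕ} (hS : 1 ≤ S) {Δ : ℝ} (hΔ : 1 < Δ) {a b : ℝ → ℝ} {t : ℝ}
    (ha : 0 ≤ a t) (hb : 0 ≤ b t) (k : ℕ) :
    rate S a b Δ t ≤ alpha (queueBirth a) (queueDeath S b) (queueDelta S Δ) k t := by
  have h1 := mul_le_mul_of_nonneg_left (rateConst_mul_le_min_sub hS hΔ k) hb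
  have h2 := mul_le_mul_of_nonneg_right (queueDelta_le_one_add hS hΔ (k + 1)) ha
  unfold rate alpha queueBirth queueDeath
  linarith

lemma one_lt_liminf_queueDelta {S : ℕ} (hS : 1 ≤ S) {Δ : ℝ} (hΔ : 1 < Δ) :
    (1 : EReal) < liminf (fun k => (queueDelta S Δ k : EReal)) atTop := by
  have h : (fun k => (queueDelta S Δ k : EReal)) =ᶠ[atTop]
      fun _ => ((1 + rateConst S Δ * Δ : ℝ) : EReal) :=
    (eventually_ge_atTop S).mono fun k hk => by simp [queueDelta, not_lt.2 hk]
  rw [liminf_congr h, liminf_const]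
  have := mul_pos (rateConst_pos hS hΔ) (by linarith : 0 < Δ)
  exact_mod_cast (by linarith : (1 : ℝ) < 1 + rateConst S Δ * Δ)

/-- The weights: `0` at `0` and `∏_{j=1}^{k} δ_j` at `k + 1`. -/
def queueWeight (S : ℕ) (Δ : ℝ) : ℕ → ℝ
  | 0 => 0
  | k + 1 => ∏ j ∈ Finset.range k, queueDelta S Δ (j + 1)

lemma queueWeight_succ_succ (S : ℕ) (Δ : ℝ) (k : ℕ) :
    queueWeight S Δ (k + 2) = queueDelta S Δ (k + 1) * queueWeight S Δ (k + 1) := by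
  simp [queueWeight, Finset.prod_range_succ, mul_comm]

lemma one_le_queueWeight_succ {S : ℕ} (hS : 1 ≤ S) {Δ : ℝ} (hΔ : 1 < Δ) (k : ℕ) :
    1 ≤ queueWeight S Δ (k + 1) := by
  induction k with
  | zero => simp [queueWeight]
  | succ k ih =>
    rw [queueWeight_succ_succ]
    exact one_le_mul_of_one_le_of_one_le (one_le_queueDelta hS hΔ _) ih

lemma queueWeight_succ_le_pow {S : ℕ} (hS : 1 ≤ S) {Δ : ℝ} (hΔ : 1 < Δ) (k : ℕ) :
    queueWeight S Δ (k + 1) ≤ Δ ^ k := by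
  simpa [queueWeight] using Finset.prod_le_prod (s := Finset.range k)
    (fun j _ => zero_le_one.trans (one_le_queueDelta hS hΔ (j + 1)))
    (fun j _ => queueDelta_le hS hΔ (j + 1))

lemma queueWeight_nonneg {S : ℕ} (hS : 1 ≤ S) {Δ : ℝ} (hΔ : 1 < Δ) :
    ∀ k, 0 ≤ queueWeight S Δ k
  | 0 => le_rfl
  | k + 1 => zero_le_one.trans (one_le_queueWeight_succ hS hΔ k)

lemma queueWeight_monotone {S : ℕ} (hS : 1 ≤ S) {Δ : ℝ} (hΔ : 1 < Δ) :
    Monotone (queueWeight S Δ) := by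
  refine monotone_nat_of_le_succ fun k => ?_
  cases k with
  | zero => exact queueWeight_nonneg hS hΔ 1
  | succ k =>
    rw [queueWeight_succ_succ]
    exact le_mul_of_one_le_left (queueWeight_nonneg hS hΔ _) (one_le_queueDelta hS hΔ _)

lemma alpha_mul_queueWeight {S : ℕ} (hS : 1 ≤ S) {Δ : ℝ} (hΔ : 1 < Δ) (a b : ℝ → ℝ) (t : ℝ)
    (k : ℕ) :
    alpha (queueBirth a) (queueDeath S b) (queueDelta S Δ) k t * queueWeight S Δ (k + 1) =
      (queueBirth a k t + queueDeath S b (k + 1) t) * queueWeight S Δ (k + 1) -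
        queueBirth a (k + 1) t * queueWeight S Δ (k + 2) -
        queueDeath S b k t * queueWeight S Δ k := by
  unfold alpha
  rw [queueWeight_succ_succ]
  cases k with
  -- The identity δ_k⁻¹ v_{k+1} = v_k fails at k = 0, but there it is multiplied by μ_0 = 0.
  | zero => simp [queueDeath]; ring
  | succ k =>
    have h0 : queueDelta S Δ (k + 1) ≠ 0 := by linarith [one_le_queueDelta hS hΔ (k + 1)]
    rw [queueWeight_succ_succ]
    field_simp

/-! ### The system of partial sums. -/

/-- Transitions inside {0, …, k} cancel; only the flow between k and k + 1 survives. -/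
lemma sum_forwardRHS (lam mu : ℕ → ℝ → ℝ) (t : ℝ) (x : ℕ → ℝ) (k : ℕ) :
    ∑ i ∈ Finset.range (k + 1), forwardRHS lam mu t x i =
      mu (k + 1) t * x (k + 1) - lam k t * x k := by
  induction k with
  | zero => simp [forwardRHS]
  | succ k ih =>
    rw [Finset.sum_range_succ, ih, forwardRHS]
    ring

namespace IsStateProbability

variable {lam mu : ℕ → ℝ → ℝ} {p : ℝ → ℕ → ℝ} {s t : ℝ}

lemma absolutelyContinuous (hp : IsStateProbability lam mu p) (hs : 0 ≤ s) (hst : s ≤ t) (n : ℕ) :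
    AbsolutelyContinuousOnInterval (fun u => p u n) s t := by
  have ht := hs.trans hst
  have h1 : AbsolutelyContinuousOnInterval
      (fun u => p 0 n + ∫ v in (0 : ℝ)..u, forwardRHS lam mu v (p v) n) 0 t :=
    (LipschitzWith.const (p 0 n)).lipschitzOnWith.absolutelyContinuousOnInterval.fun_add
      ((hp.intervalIntegrable n t ht).absolutelyContinuousOnInterval_intervalIntegral (by simp))
  refine (absolutelyContinuousOnInterval_congr h1 fun u hu => ?_).mono ?_
  · rw [Set.uIcc_of_le ht] at hu
    exact (hp.eq_integral n u hu.1).symm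
  · rw [Set.uIcc_of_le ht, Set.uIcc_of_le hst]
    exact Set.Icc_subset_Icc_left hs

lemma ae_hasDerivAt (hp : IsStateProbability lam mu p) (hs : 0 ≤ s) (hst : s ≤ t) (n : ℕ) :
    ∀ᵐ u, u ∈ Set.Ioo s t → HasDerivAt (fun v => p v n) (forwardRHS lam mu u (p u) n) u := by
  have ht := hs.trans hst
  filter_upwards [(hp.intervalIntegrable n t ht).ae_hasDerivAt_integral] with u h hu
  have hu0 : 0 < u := hs.trans_lt hu.1
  refine ((h ?_ 0 (by simp)).const_add (p 0 n)).congr_of_eventuallyEq ?_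
  · rw [Set.uIcc_of_le ht]
    exact ⟨hu0.le, hu.2.le⟩
  · filter_upwards [lt_mem_nhds hu0] with v hv
    exact hp.eq_integral n v hv.le

end IsStateProbability

/-- Partial sums of the difference of two vector-valued functions. -/
def partialDiff (p₁ p₂ : ℝ → ℕ → ℝ) (k : ℕ) (u : ℝ) : ℝ :=
  ∑ i ∈ Finset.range k, (p₁ u i - p₂ u i)

variable {lam mu : ℕ → ℝ → ℝ} {p₁ p₂ : ℝ → ℕ → ℝ} {s t : ℝ}

lemma partialDiff_succ (p₁ p₂ : ℝ → ℕ → ℝ) (k : ℕ) (u : ℝ) :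
    partialDiff p₁ p₂ (k + 1) u = partialDiff p₁ p₂ k u + (p₁ u k - p₂ u k) :=
  Finset.sum_range_succ _ _

lemma partialDiff_absolutelyContinuous (h₁ : IsStateProbability lam mu p₁)
    (h₂ : IsStateProbability lam mu p₂) (hs : 0 ≤ s) (hst : s ≤ t) (k : ℕ) :
    AbsolutelyContinuousOnInterval (partialDiff p₁ p₂ k) s t :=
  absolutelyContinuousOnInterval_sum _ fun i _ =>
    (h₁.absolutelyContinuous hs hst i).fun_sub (h₂.absolutelyContinuous hs hst i)

lemma partialDiff_ae_hasDerivAt (h₁ : IsStateProbability lam mu p₁)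
    (h₂ : IsStateProbability lam mu p₂) (hs : 0 ≤ s) (hst : s ≤ t) (k : ℕ) :
    ∀ᵐ u, u ∈ Set.Ioo s t → HasDerivAt (partialDiff p₁ p₂ (k + 1))
      (-(lam k u + mu (k + 1) u) * partialDiff p₁ p₂ (k + 1) u +
        (lam k u * partialDiff p₁ p₂ k u + mu (k + 1) u * partialDiff p₁ p₂ (k + 2) u)) u := by
  filter_upwards [ae_all_iff.2 (h₁.ae_hasDerivAt hs hst), ae_all_iff.2 (h₂.ae_hasDerivAt hs hst)]
    with u hu₁ hu₂ hu
  have h := HasDerivAt.fun_sum (u := Finset.range (k + 1))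
    fun i _ => (hu₁ i hu).fun_sub (hu₂ i hu)
  rw [Finset.sum_sub_distrib, sum_forwardRHS, sum_forwardRHS] at h
  refine h.congr_deriv ?_
  rw [partialDiff_succ _ _ (k + 1), partialDiff_succ _ _ k]
  ring

lemma hasSum_diff (h₁ : IsStateProbability lam mu p₁)
    (h₂ : IsStateProbability lam mu p₂) (ht : 0 ≤ t) : HasSum (fun i => p₁ t i - p₂ t i) 0 := by
  simpa using (h₁.hasSum_one t ht).sub (h₂.hasSum_one t ht)

lemma abs_partialDiff_le (h₁ : IsStateProbability lam mu p₁)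
    (h₂ : IsStateProbability lam mu p₂) (ht : 0 ≤ t) (k : ℕ) : |partialDiff p₁ p₂ k t| ≤ 1 := by
  unfold partialDiff
  rw [Finset.sum_sub_distrib]
  have e₁ := sum_le_hasSum (Finset.range k) (fun i _ => h₁.nonneg t ht i) (h₁.hasSum_one t ht)
  have e₂ := sum_le_hasSum (Finset.range k) (fun i _ => h₂.nonneg t ht i) (h₂.hasSum_one t ht)
  have n₁ := Finset.sum_nonneg fun i (_ : i ∈ Finset.range k) => h₁.nonneg t ht i
  have n₂ := Finset.sum_nonneg fun i (_ : i ∈ Finset.range k) => h₂.nonneg t ht i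
  rw [abs_le]
  constructor <;> linarith

lemma tendsto_partialDiff (h₁ : IsStateProbability lam mu p₁)
    (h₂ : IsStateProbability lam mu p₂) (ht : 0 ≤ t) :
    Tendsto (fun k => partialDiff p₁ p₂ k t) atTop (𝓝 0) :=
  (hasSum_diff h₁ h₂ ht).tendsto_sum_nat

/-! ### Decay for the queue: a priori bound, then sharp rate. -/

section Decay

variable {S : ℕ} {Δ : ℝ} {a b : ℝ → ℝ} {p₁ p₂ : ℝ → ℕ → ℝ} {s t V : ℝ}

lemma queueDeath_nonneg (hb : IsIntensity b) (k : ℕ) {u : ℝ} (hu : 0 ≤ u) :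
    0 ≤ queueDeath S b k u :=
  mul_nonneg (hb.nonneg u hu) (Nat.cast_nonneg _)

lemma queueDeath_mono (hb : IsIntensity b) {u : ℝ} (hu : 0 ≤ u) :
    Monotone fun k => queueDeath S b k u := fun k l hkl =>
  mul_le_mul_of_nonneg_left (by exact_mod_cast min_le_min_right S hkl) (hb.nonneg u hu)

lemma queueDeath_le (hb : IsIntensity b) (k : ℕ) {u : ℝ} (hu : 0 ≤ u) :
    queueDeath S b k u ≤ b u * S :=
  mul_le_mul_of_nonneg_left (by exact_mod_cast min_le_right k S) (hb.nonneg u hu)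

/-- A priori bound, uniform in `N`. Weights capped at `M` are bounded, so the boundary terms vanish
merely because |Z_k| ≤ 1 and Z_k → 0. Capping preserves monotonicity and the ratio bound Δ, which
suffices for the rate -Δa. -/
lemma weightedSum_le_exp_mul (hS : 1 ≤ S) (hΔ : 1 < Δ) (ha : IsIntensity a) (hb : IsIntensity b)
    (h₁ : IsStateProbability (queueBirth a) (queueDeath S b) p₁)
    (h₂ : IsStateProbability (queueBirth a) (queueDeath S b) p₂) (hs : 0 ≤ s) (hst : s ≤ t)
    (hV : ∀ N, ∑ k ∈ Finset.range N, queueWeight S Δ (k + 1) * |partialDiff p₁ p₂ (k + 1) s| ≤ V)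
    (N : ℕ) :
    ∑ k ∈ Finset.range N, queueWeight S Δ (k + 1) * |partialDiff p₁ p₂ (k + 1) t| ≤
      Real.exp (∫ u in s..t, Δ * a u) * V := by
  have hint {f : ℝ → ℝ} (hf : IsIntensity f) := hf.intervalIntegrable hs hst
  have hmono := queueWeight_monotone hS hΔ
  have hnn := queueWeight_nonneg hS hΔ
  set M := queueWeight S Δ N with hM
  set v : ℕ → ℝ := fun k => min (queueWeight S Δ k) M with hv
  have hvM : ∀ k, v k ≤ M := fun k => min_le_right _ _
  have hv0 : ∀ k, 0 ≤ v k := fun k => le_min (hnn k) (hnn N)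
  have hvmono : ∀ k, v k ≤ v (k + 1) := fun k => min_le_min_right _ (hmono k.le_succ)
  have hvratio : ∀ k, v (k + 2) ≤ Δ * v (k + 1) := by
    intro k
    simp only [hv]
    rw [mul_min_of_nonneg _ _ (by linarith : 0 ≤ Δ)]
    refine min_le_min ?_ (le_mul_of_one_le_left (hnn N) hΔ.le)
    rw [queueWeight_succ_succ]
    exact mul_le_mul_of_nonneg_right (queueDelta_le hS hΔ _) (hnn _)
  have key := exp_mul_weightedSum_le (lam := queueBirth a) (mu := queueDeath S b)
    (Z := partialDiff p₁ p₂) (v := v) (r := fun u => -(Δ * a u)) (g := fun u => b u * S)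
    (K := M) (V := V) hst
    (fun k u hu => ha.nonneg u (hs.trans hu.1))
    (fun k u hu => queueDeath_nonneg hb k (hs.trans hu.1))
    (fun k => (hint hb).mul_const _) ((hint hb).mul_const _)
    (fun k u hu => queueDeath_le hb k (hs.trans hu.1)) ((hint ha).const_mul Δ).neg
    (fun u => by simp [partialDiff]) (partialDiff_absolutelyContinuous h₁ h₂ hs hst)
    (partialDiff_ae_hasDerivAt h₁ h₂ hs hst) (min_eq_left (hnn N)) hv0 ?_ ?_ ?_ ?_ N
  · rw [intervalIntegral.integral_neg, Real.exp_neg, inv_mul_le_iff₀ (Real.exp_pos _)] at key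
    refine le_trans (Finset.sum_le_sum fun k hk => ?_) key
    simp only [hv]
    -- The cap is the weight of index `N`, so the weights of indices 1, …, `N` are unchanged.
    rw [min_eq_left (hmono (Finset.mem_range.1 hk))]
  · intro k u hu
    have hu0 := hs.trans hu.1
    have e₁ := mul_le_mul_of_nonneg_left (hvratio k) (ha.nonneg u hu0)
    have e₂ := mul_le_mul (queueDeath_mono (S := S) hb hu0 k.le_succ) (hvmono k) (hv0 _)
      (queueDeath_nonneg hb _ hu0)
    have e₃ := mul_nonneg (ha.nonneg u hu0) (hv0 (k + 1))
    simp only [queueBirth, Nat.succ_eq_add_one] at e₂ ⊢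
    linarith
  · intro k u hu
    have := mul_le_mul (hvM k) (abs_partialDiff_le h₁ h₂ (hs.trans hu.1) (k + 1))
      (abs_nonneg _) (hnn N)
    linarith
  · intro u hu
    have h0 := (((tendsto_partialDiff h₁ h₂ (hs.trans hu.1)).comp
      (tendsto_add_atTop_nat 1)).abs).const_mul M
    rw [abs_zero, mul_zero] at h0
    exact squeeze_zero (fun k => mul_nonneg (hv0 k) (abs_nonneg _))
      (fun k => mul_le_mul_of_nonneg_right (hvM k) (abs_nonneg _)) h0
  · exact fun n => (Finset.sum_le_sum fun k _ =>
      mul_le_mul_of_nonneg_right (min_le_left _ _) (abs_nonneg _)).trans (hV n)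

lemma exp_rate_mul_weightedSum_le (hS : 1 ≤ S) (hΔ : 1 < Δ) (ha : IsIntensity a)
    (hb : IsIntensity b)
    (h₁ : IsStateProbability (queueBirth a) (queueDeath S b) p₁)
    (h₂ : IsStateProbability (queueBirth a) (queueDeath S b) p₂) (hs : 0 ≤ s) (hst : s ≤ t)
    (hV : ∀ N, ∑ k ∈ Finset.range N, queueWeight S Δ (k + 1) * |partialDiff p₁ p₂ (k + 1) s| ≤ V)
    (N : ℕ) :
    Real.exp (∫ u in s..t, rate S a b Δ u) *
      ∑ k ∈ Finset.range N, queueWeight S Δ (k + 1) * |partialDiff p₁ p₂ (k + 1) t| ≤ V := by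
  have hint {f : ℝ → ℝ} (hf : IsIntensity f) := hf.intervalIntegrable hs hst
  have hmono := queueWeight_monotone hS hΔ
  have hnn := queueWeight_nonneg hS hΔ
  have hterm : ∀ k u, 0 ≤ queueWeight S Δ (k + 1) * |partialDiff p₁ p₂ (k + 1) u| :=
    fun k u => mul_nonneg (hnn _) (abs_nonneg _)
  have hV0 : 0 ≤ V := by simpa using hV 0
  have hK : ∀ u ∈ Set.Icc s t, ∀ n,
      ∑ k ∈ Finset.range n, queueWeight S Δ (k + 1) * |partialDiff p₁ p₂ (k + 1) u| ≤
        Real.exp (∫ u in s..t, Δ * a u) * V := by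
    intro u hu n
    refine (weightedSum_le_exp_mul hS hΔ ha hb h₁ h₂ hs hu.1 hV n).trans ?_
    refine mul_le_mul_of_nonneg_right (Real.exp_le_exp.2 ?_) hV0
    refine intervalIntegral.integral_mono_interval le_rfl hu.1 hu.2 ?_ ((hint ha).const_mul Δ)
    refine (ae_restrict_iff' measurableSet_Ioc).2 (Eventually.of_forall fun w hw => ?_)
    exact mul_nonneg (by linarith) (ha.nonneg w (hs.trans hw.1.le))
  have hle : ∀ k u, queueWeight S Δ k * |partialDiff p₁ p₂ (k + 1) u| ≤
      queueWeight S Δ (k + 1) * |partialDiff p₁ p₂ (k + 1) u| := fun k u =>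
    mul_le_mul_of_nonneg_right (hmono k.le_succ) (abs_nonneg _)
  refine exp_mul_weightedSum_le (lam := queueBirth a) (mu := queueDeath S b)
    (Z := partialDiff p₁ p₂) (v := queueWeight S Δ) (g := fun u => b u * S)
    (K := Real.exp (∫ u in s..t, Δ * a u) * V) hst
    (fun k u hu => ha.nonneg u (hs.trans hu.1))
    (fun k u hu => queueDeath_nonneg hb k (hs.trans hu.1))
    (fun k => (hint hb).mul_const _) ((hint hb).mul_const _)
    (fun k u hu => queueDeath_le hb k (hs.trans hu.1))
    ((((hint hb).const_mul _).sub ((hint ha).const_mul _)).const_mul _)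
    (fun u => by simp [partialDiff]) (partialDiff_absolutelyContinuous h₁ h₂ hs hst)
    (partialDiff_ae_hasDerivAt h₁ h₂ hs hst) rfl hnn ?_ ?_ ?_ hV N
  · intro k u hu
    have hu0 := hs.trans hu.1
    rw [← alpha_mul_queueWeight hS hΔ]
    exact mul_le_mul_of_nonneg_right (rate_le_alpha hS hΔ (ha.nonneg u hu0) (hb.nonneg u hu0) k)
      (hnn _)
  · intro k u hu
    refine ((hle k u).trans ?_).trans (hK u hu (k + 1))
    exact Finset.single_le_sum (fun i _ => hterm i u) (Finset.self_mem_range_succ k)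
  · intro u hu
    -- The a priori bound makes the weighted series converge, so its terms, which dominate the
    -- boundary ones, tend to 0.
    have h0 := (summable_of_sum_range_le (fun k => hterm k u) (hK u hu)).tendsto_atTop_zero
    exact squeeze_zero (fun k => mul_nonneg (hnn k) (abs_nonneg _)) (fun k => hle k u) h0

end Decay

/-! ### Comparison of weighted sums with the two distances. -/

section Distances

variable {lam mu : ℕ → ℝ → ℝ} {p₁ p₂ : ℝ → ℕ → ℝ} {t : ℝ}

/-- Each coordinate is Z_{i+1} - Z_i, so every partial sum is used at most twice: hence the factor
2. -/
lemma l1Dist_le_of_weightedSum_le {v : ℕ → ℝ} (hv : ∀ k, 1 ≤ v (k + 1)) {C : ℝ}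
    (hC : ∀ N, ∑ k ∈ Finset.range N, v (k + 1) * |partialDiff p₁ p₂ (k + 1) t| ≤ C) :
    l1Dist (p₁ t) (p₂ t) ≤ ENNReal.ofReal (2 * C) := by
  refine ENNReal.tsum_le_of_sum_range_le fun N => ?_
  rw [← ENNReal.ofReal_sum_of_nonneg fun _ _ => abs_nonneg _]
  refine ENNReal.ofReal_le_ofReal ?_
  have h : ∀ N, ∑ k ∈ Finset.range N, |partialDiff p₁ p₂ (k + 1) t| ≤ C := fun N =>
    (Finset.sum_le_sum fun k _ => le_mul_of_one_le_left (abs_nonneg _) (hv k)).trans (hC N)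
  have h' : ∀ N, ∑ k ∈ Finset.range N, |partialDiff p₁ p₂ k t| ≤ C := by
    intro N
    cases N with
    | zero => simpa using h 0
    | succ N =>
      rw [Finset.sum_range_succ']
      simpa [partialDiff] using h N
  calc ∑ i ∈ Finset.range N, |p₁ t i - p₂ t i|
      ≤ ∑ i ∈ Finset.range N, (|partialDiff p₁ p₂ (i + 1) t| + |partialDiff p₁ p₂ i t|) := by
        refine Finset.sum_le_sum fun i _ => ?_
        rw [show p₁ t i - p₂ t i = partialDiff p₁ p₂ (i + 1) t - partialDiff p₁ p₂ i t by
          rw [partialDiff_succ]; ring]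
        exact abs_sub _ _
    _ ≤ 2 * C := by
        rw [Finset.sum_add_distrib]
        linarith [h N, h' N]

/-- The difference has total mass zero, so a head sum is minus the complementary tail. -/
lemma ofReal_abs_partialDiff_le (h₁ : IsStateProbability lam mu p₁)
    (h₂ : IsStateProbability lam mu p₂) (ht : 0 ≤ t) (k : ℕ) :
    ENNReal.ofReal |partialDiff p₁ p₂ (k + 1) t| ≤
      ∑' i, if k < i then ENNReal.ofReal |p₁ t i - p₂ t i| else 0 := by
  have h0 := tendsto_partialDiff h₁ h₂ ht
  have hlim : Tendsto (fun n => ENNReal.ofReal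
      |partialDiff p₁ p₂ n t - partialDiff p₁ p₂ (k + 1) t|) atTop
      (𝓝 (ENNReal.ofReal |partialDiff p₁ p₂ (k + 1) t|)) := by
    refine ENNReal.tendsto_ofReal ?_
    simpa using (h0.sub_const (partialDiff p₁ p₂ (k + 1) t)).abs
  refine le_of_tendsto hlim ((eventually_ge_atTop (k + 1)).mono fun n hn => ?_)
  rw [partialDiff, partialDiff, ← Finset.sum_Ico_eq_sub _ hn]
  refine le_trans ?_ (ENNReal.sum_le_tsum (Finset.Ico (k + 1) n))
  refine (ENNReal.ofReal_le_ofReal (Finset.abs_sum_le_sum_abs _ _)).trans ?_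
  rw [ENNReal.ofReal_sum_of_nonneg fun _ _ => abs_nonneg _]
  refine Finset.sum_le_sum fun i hi => ?_
  rw [if_pos (Nat.lt_of_succ_le (Finset.mem_Ico.1 hi).1)]

lemma ofReal_weightedSum_le_weightedDist (h₁ : IsStateProbability lam mu p₁)
    (h₂ : IsStateProbability lam mu p₂) (ht : 0 ≤ t) {ρ : ℝ} {v : ℕ → ℝ} (hv0 : ∀ k, 0 ≤ v k)
    (hv : ∀ k, v (k + 1) ≤ ρ ^ (-(k : ℝ) / 2)) (N : ℕ) :
    ENNReal.ofReal (∑ k ∈ Finset.range N, v (k + 1) * |partialDiff p₁ p₂ (k + 1) t|) ≤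
      weightedDist ρ (p₁ t) (p₂ t) := by
  rw [ENNReal.ofReal_sum_of_nonneg fun k _ => mul_nonneg (hv0 _) (abs_nonneg _)]
  calc ∑ k ∈ Finset.range N, ENNReal.ofReal (v (k + 1) * |partialDiff p₁ p₂ (k + 1) t|)
      ≤ ∑ k ∈ Finset.range N, ∑' i, ENNReal.ofReal (v (k + 1)) *
          (if k < i then ENNReal.ofReal |p₁ t i - p₂ t i| else 0) := by
        refine Finset.sum_le_sum fun k _ => ?_
        rw [ENNReal.ofReal_mul (hv0 _), ENNReal.tsum_mul_left]
        gcongr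
        exact ofReal_abs_partialDiff_le h₁ h₂ ht k
    _ = ∑' i, ∑ k ∈ Finset.range N, ENNReal.ofReal (v (k + 1)) *
          (if k < i then ENNReal.ofReal |p₁ t i - p₂ t i| else 0) :=
        (Summable.tsum_finsetSum fun _ _ => ENNReal.summable).symm
    _ ≤ weightedDist ρ (p₁ t) (p₂ t) := by
        refine ENNReal.tsum_le_tsum fun i => ?_
        have hle : ∀ k : ℕ, 0 ≤ ρ ^ (-(k : ℝ) / 2) := fun k => (hv0 _).trans (hv k)
        rw [ENNReal.ofReal_mul (Finset.sum_nonneg fun k _ => hle k),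
          ENNReal.ofReal_sum_of_nonneg fun k _ => hle k, Finset.sum_mul]
        -- After the interchange of sums, coordinate i collects only the weights with k < min(i, N).
        simp only [mul_ite, mul_zero]
        rw [← Finset.sum_filter]
        refine (Finset.sum_le_sum_of_subset fun k hk => ?_).trans
          (Finset.sum_le_sum fun k _ => ?_)
        · exact Finset.mem_range.2 (Finset.mem_filter.1 hk).2
        · gcongr
          exact hv k

end Distances

end BDQueue

end

theorem mainTheorem9
    (S : ℕ) (hS : 1 ≤ S)
    (a b a₁ a₂ b₁ b₂ : ℝ → ℝ) (T₁ T₂ : ℝ)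
    (ha : BDQueue.IsIntensity a) (hb : BDQueue.IsIntensity b)
    (hap : BDQueue.IsAsympPeriodic a a₁ a₂ T₁) (hbp : BDQueue.IsAsympPeriodic b b₁ b₂ T₂)
    (hunder : BDQueue.periodMean a₁ T₁ < (S : ℝ) * BDQueue.periodMean b₁ T₂) :
    (∀ Δ : ℝ, 1 < Δ → ∃ δ : ℕ → ℝ, (∀ k, 0 < δ k) ∧
      (1 : EReal) < liminf (fun k => (δ k : EReal)) atTop ∧
      ∀ t : ℝ, 0 ≤ t →
        BddBelow (Set.range fun k =>
          BDQueue.alpha (BDQueue.queueBirth a) (BDQueue.queueDeath S b) δ k t) ∧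
        BDQueue.rate S a b Δ t ≤
          BDQueue.alphaInf (BDQueue.queueBirth a) (BDQueue.queueDeath S b) δ t) ∧
    (0 < BDQueue.periodMean a₁ T₁ →
      ∀ ρ : ℝ, ρ = BDQueue.periodMean a₁ T₁ / ((S : ℝ) * BDQueue.periodMean b₁ T₂) →
      ∀ p₁ p₂ : ℝ → ℕ → ℝ,
        BDQueue.IsStateProbability (BDQueue.queueBirth a) (BDQueue.queueDeath S b) p₁ →
        BDQueue.IsStateProbability (BDQueue.queueBirth a) (BDQueue.queueDeath S b) p₂ →
        ∀ s t : ℝ, 0 ≤ s → s ≤ t →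
          BDQueue.l1Dist (p₁ t) (p₂ t) ≤
            ENNReal.ofReal
                (4 * Real.exp (-∫ u in s..t, BDQueue.rate S a b (ρ ^ (-(1 / 2) : ℝ)) u)) *
              BDQueue.weightedDist ρ (p₁ s) (p₂ s)) := by
  refine ⟨fun Δ hΔ => ⟨BDQueue.queueDelta S Δ,
    fun k => zero_lt_one.trans_le (BDQueue.one_le_queueDelta hS hΔ k),
    BDQueue.one_lt_liminf_queueDelta hS hΔ, fun t ht => ?_⟩, ?_⟩
  · have h := fun k => BDQueue.rate_le_alpha hS hΔ (ha.nonneg t ht) (hb.nonneg t ht) k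
    -- Boundedness below makes the real `⨅` a genuine infimum rather than the default value 0.
    exact ⟨⟨_, Set.forall_mem_range.2 h⟩, le_ciInf h⟩
  · intro hpos ρ hρ p₁ p₂ h₁ h₂ s t hs hst
    have hρ0 : 0 < ρ := hρ ▸ div_pos hpos (hpos.trans hunder)
    have hρ1 : ρ < 1 := hρ ▸ (div_lt_one (hpos.trans hunder)).2 hunder
    set Δ : ℝ := ρ ^ (-(1 / 2) : ℝ) with hΔdef
    have hΔ : 1 < Δ := Real.one_lt_rpow_of_pos_of_lt_one_of_neg hρ0 hρ1 (by norm_num)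
    have hweight : ∀ k, BDQueue.queueWeight S Δ (k + 1) ≤ ρ ^ (-(k : ℝ) / 2) := fun k => by
      refine (BDQueue.queueWeight_succ_le_pow hS hΔ k).trans_eq ?_
      rw [hΔdef, ← Real.rpow_mul_natCast hρ0.le]
      ring_nf
    have hbound := BDQueue.ofReal_weightedSum_le_weightedDist h₁ h₂ hs
      (BDQueue.queueWeight_nonneg hS hΔ) hweight
    set D := BDQueue.weightedDist ρ (p₁ s) (p₂ s) with hD
    -- If the initial distance is infinite, the positive factor keeps the right side infinite.
    rcases eq_or_ne D ⊤ with hDtop | hDtop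
    · rw [hDtop, ENNReal.mul_top (by simpa using Real.exp_pos _)]
      exact le_top
    have hdecay := BDQueue.exp_rate_mul_weightedSum_le hS hΔ ha hb h₁ h₂ hs hst (V := D.toReal)
      fun N => (ENNReal.ofReal_le_iff_le_toReal hDtop).1 (hbound N)
    refine (BDQueue.l1Dist_le_of_weightedSum_le (BDQueue.one_le_queueWeight_succ hS hΔ)
      (C := Real.exp (-∫ u in s..t, BDQueue.rate S a b Δ u) * D.toReal) fun N => ?_).trans ?_
    · rw [Real.exp_neg, ← div_eq_inv_mul, le_div_iff₀' (Real.exp_pos _)]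
      exact hdecay N
    · rw [← mul_assoc, ENNReal.ofReal_mul (by positivity), ENNReal.ofReal_toReal hDtop]
      gcongr
      -- The argument yields the constant 2, which is better than 4.
      norm_num
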